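/- For a finite group $G$ let $\mathrm{Irr}(G)$ be the set of its irreducible complex characters, let $\mathrm{cod}(\chi)=|G:\ker\chi|/\chi(1)$ be the codegree of $\chi\in\mathrm{Irr}(G)$, and let $\mathrm{cod}(G)=\{\mathrm{cod}(\chi) : \chi\in\mathrm{Irr}(G)\}$. The codegree prime graph of $G$ is the simple undirected graph whose vertices are the primes dividing some member of $\mathrm{cod}(G)$, where two distinct vertices $p,q$ are adjacent if and only if $pq$ divides some member of $\mathrm{cod}(G)$. Let $F$ be a finite simple graph, and let $\overline{F}$ denote its complement. Then $F$ is isomorphic to the codegree prime graph of some finite solvable group of square-free order if and only if $\overline{F}$ is $2$-colorable. -/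

import Mathlib

namespace CodegreeGraph

/-- The kernel of the character of a complex representation `ρ` of a finite group, namely
`{g | χ g = χ 1}` where `χ = ρ.character`, is the kernel of `ρ` itself. -/
theorem character_eq_iff_mem_ker {G : Type*} [Group G] [Finite G] {n : ℕ}
    (ρ : Representation ℂ G (Fin n → ℂ)) (g : G) :
    ρ.character g = ρ.character 1 ↔ g ∈ MonoidHom.ker ρ := by
  have hone : ρ.character 1 = (n : ℂ) := by simp
  rw [hone, MonoidHom.mem_ker]
  constructor
  · intro h
    have hm : orderOf g ≠ 0 := (orderOf_pos g).ne'
    have hpow : (ρ g) ^ orderOf g = 1 := by rw [← map_pow, pow_orderOf_eq_one, map_one]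
    have hroot : ∀ z ∈ (LinearMap.charpoly (ρ g)).roots, z ^ orderOf g = 1 := by
      intro z hz
      have he := (Module.End.hasEigenvalue_iff_isRoot_charpoly (ρ g) z).2
        (Polynomial.isRoot_of_mem_roots hz)
      obtain ⟨v, hv⟩ := he.exists_hasEigenvector
      have h1 := hv.pow_apply (orderOf g)
      rw [hpow, Module.End.one_apply] at h1
      have h2 : (z ^ orderOf g - 1) • v = 0 := by rw [sub_smul, ← h1, one_smul, sub_self]
      exact sub_eq_zero.1 ((smul_eq_zero.1 h2).resolve_right hv.2)
    have hsum : (LinearMap.charpoly (ρ g)).roots.sum = (n : ℂ) := by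
      rw [← h, ← LinearMap.charpoly_toMatrix (ρ g) (Pi.basisFun ℂ (Fin n)),
        ← Matrix.trace_eq_sum_roots_charpoly]
      exact (LinearMap.trace_eq_matrix_trace ℂ (Pi.basisFun ℂ (Fin n)) (ρ g)).symm
    have hcard : (LinearMap.charpoly (ρ g)).roots.card = n := by
      rw [IsAlgClosed.card_roots_eq_natDegree, LinearMap.charpoly_natDegree]
      simp
    have hre : ((LinearMap.charpoly (ρ g)).roots.map (fun z => 1 - z.re)).sum = 0 := by
      have h3 := congrArg Complex.reAddGroupHom hsum
      rw [map_multiset_sum] at h3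
      have h4 : ((LinearMap.charpoly (ρ g)).roots.map (fun z => z.re)).sum = n := by
        simpa using h3
      rw [Multiset.sum_map_sub, h4]
      simp [hcard]
    have hall : ∀ z ∈ (LinearMap.charpoly (ρ g)).roots, z = 1 := by
      intro z hz
      have hnn : ∀ w ∈ (LinearMap.charpoly (ρ g)).roots, 0 ≤ 1 - w.re := by
        intro w hw
        have := Complex.norm_eq_one_of_pow_eq_one (hroot w hw) hm
        have := Complex.re_le_norm w
        linarith
      have h5 : 1 - z.re ≤ 0 := by
        rw [← hre]
        refine Multiset.single_le_sum ?_ _ (Multiset.mem_map_of_mem _ hz)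
        intro x hx
        obtain ⟨w, hw, rfl⟩ := Multiset.mem_map.1 hx
        exact hnn w hw
      have h6 := Complex.norm_eq_one_of_pow_eq_one (hroot z hz) hm
      have h7 := hnn z hz
      have h8 : z.re = 1 := by linarith
      have h9 := Complex.sq_norm z
      rw [h6, Complex.normSq_apply, h8] at h9
      apply Complex.ext
      · simp [h8]
      · have : z.im * z.im = 0 := by linarith
        simpa using this
    have hss : Module.End.IsSemisimple (ρ g) := by
      refine Module.End.isSemisimple_of_squarefree_aeval_eq_zero
        (p := Polynomial.X ^ orderOf g - Polynomial.C 1)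
        (Polynomial.separable_X_pow_sub_C 1 (by exact_mod_cast hm) one_ne_zero).squarefree ?_
      simp [hpow]
    have htop : Module.End.eigenspace (ρ g) 1 = ⊤ := by
      rw [eq_top_iff, ← Module.End.iSup_maxGenEigenspace_eq_top (ρ g)]
      refine iSup_le fun z => ?_
      rw [hss.isFinitelySemisimple.maxGenEigenspace_eq_eigenspace]
      by_cases hz : Module.End.HasEigenvalue (ρ g) z
      · have hr := (Module.End.hasEigenvalue_iff_isRoot_charpoly (ρ g) z).1 hz
        rw [hall z ((Polynomial.mem_roots (LinearMap.charpoly_monic (ρ g)).ne_zero).2 hr)]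
      · rw [Module.End.hasEigenvalue_iff, not_not] at hz
        rw [hz]
        exact bot_le
    refine LinearMap.ext fun v => ?_
    have hv : v ∈ Module.End.eigenspace (ρ g) 1 := by rw [htop]; trivial
    simpa using Module.End.mem_eigenspace_iff.1 hv
  · intro h
    rw [← hone, Representation.character, Representation.character, h, map_one ρ]

/-- The codegree `|G : ker χ| / χ(1)` of the character `χ` of a complex representation `ρ` of a
finite group. Here `ker χ` is the kernel of `ρ` and `χ(1)` is the dimension of `ρ`. -/
noncomputable def codegree {G : Type*} [Group G] {n : ℕ}
    (ρ : Representation ℂ G (Fin n → ℂ)) : ℚ :=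
  ((MonoidHom.ker ρ).index : ℚ) / (n : ℚ)

/-- The set `cod(G)` of the codegrees of the irreducible complex characters of `G`. Every
irreducible representation of a finite group over `ℂ` is isomorphic to one on some `ℂⁿ`, and its
codegree is a positive integer. -/
def codegrees (G : Type*) [Group G] : Set ℕ :=
  {m | ∃ (n : ℕ) (ρ : Representation ℂ G (Fin n → ℂ)), ρ.IsIrreducible ∧ (m : ℚ) = codegree ρ}

/-- The vertices of the codegree prime graph: the primes dividing some member of `cod(G)`. -/
def Vertex (G : Type*) [Group G] : Type :=
  {p : ℕ // p.Prime ∧ ∃ m ∈ codegrees G, p ∣ m}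

/-- The codegree prime graph of `G`: two distinct primes `p`, `q` are adjacent if and only if `pq`
divides some member of `cod(G)`. -/
def codegreePrimeGraph (G : Type*) [Group G] : SimpleGraph (Vertex G) where
  Adj p q := p ≠ q ∧ ∃ m ∈ codegrees G, p.1 * q.1 ∣ m
  symm := ⟨fun p q ⟨h, m, hm, hd⟩ => ⟨h.symm, m, hm, by rwa [mul_comm]⟩⟩
  loopless := ⟨fun _ h => h.1 rfl⟩

end CodegreeGraph

/-! Let `G` have square-free order. If `A` is an abelian normal subgroup with cyclic quotient, its
centralizer `C` is cyclic, normal and self-centralizing; an irreducible representation containing a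
faithful weight of `C` is faithful of degree `|G : C|`, so `|C|` is a codegree
(`card_centralizer_mem_codegrees`). Since `G'` and `G/G'` are cyclic, taking `A = G'` in `G` and the
whole group in `G/G'` shows that the primes dividing `|G'|` form a clique, and so do the remaining
ones: the complement is 2-colorable.

Conversely, split the vertices of `F` into two cliques and label them by primes. In a group `ℤ/N ⋊
ℤ/M`, with one clique dividing `N` and the other `M`, let the `p`-part of `ℤ/M` act nontrivially on
the `q`-part of `ℤ/N` exactly when `p`, `q` are to be non-adjacent; Dirichlet's theorem supplies
primes `q ≡ 1` modulo the required `p`. A trivial action gives an edge by the centralizer codegree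
of the quotient `ℤ/q ⋊ ℤ/M`. A nontrivial one forbids the edge (`not_dvd_of_mem_codegrees`): a
character whose codegree is divisible by `pq` would vanish on the nontrivial elements of order `p`,
so `p` would divide its degree too and `p²` would divide `|G|`. -/

namespace CodegreeGraph

open Module

/-! ### Codegrees from self-centralizing cyclic normal subgroups. -/

section Representations

variable {G H V : Type*} [Group G] [Group H] [AddCommGroup V] [Module ℂ V]

theorem isIrreducible_iff {ρ : Representation ℂ G V} :
    ρ.IsIrreducible ↔ Nontrivial V ∧
      ∀ U : Submodule ℂ V, (∀ g, U ≤ U.comap (ρ g)) → U = ⊥ ∨ U = ⊤ := by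
  constructor
  · intro h
    refine ⟨?_, fun U hU => ?_⟩
    · by_contra hV
      rw [not_nontrivial_iff_subsingleton] at hV
      have : (⊥ : Subrepresentation ρ) = ⊤ :=
        Subrepresentation.toSubmodule_injective (Subsingleton.elim _ _)
      exact bot_ne_top this
    · rcases h.eq_bot_or_eq_top (⟨U, fun g v hv => hU g hv⟩ : Subrepresentation ρ) with h | h
      · exact .inl (congrArg Subrepresentation.toSubmodule h)
      · exact .inr (congrArg Subrepresentation.toSubmodule h)
  · rintro ⟨hV, h⟩
    have : Nontrivial (Subrepresentation ρ) :=
      ⟨⊥, ⊤, fun h => bot_ne_top (α := Submodule ℂ V)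
        (congrArg Subrepresentation.toSubmodule h)⟩
    refine ⟨fun U => ?_⟩
    rcases h U.toSubmodule (fun g v hv => U.apply_mem_toSubmodule g hv) with h | h
    · exact .inl (Subrepresentation.toSubmodule_injective h)
    · exact .inr (Subrepresentation.toSubmodule_injective h)

/-- A codegree may be computed from an irreducible representation on any finite-dimensional
space. -/
theorem mem_codegrees_of_isIrreducible [FiniteDimensional ℂ V] {ρ : Representation ℂ G V}
    (hρ : ρ.IsIrreducible) {m : ℕ} (hm : m * finrank ℂ V = (MonoidHom.ker ρ).index) :
    m ∈ codegrees G := by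
  rw [isIrreducible_iff] at hρ
  obtain ⟨hV, hirr⟩ := hρ
  let e : V ≃ₗ[ℂ] (Fin (finrank ℂ V) → ℂ) := (finBasis ℂ V).equivFun
  let σ : Representation ℂ G (Fin (finrank ℂ V) → ℂ) := (e.conjRingEquiv : _ →* _).comp ρ
  have hσ (g : G) (v) : σ g v = e (ρ g (e.symm v)) := rfl
  have hker : MonoidHom.ker σ = MonoidHom.ker ρ := by
    ext g
    simp [MonoidHom.mem_ker, σ]
  refine ⟨finrank ℂ V, σ, ?_, ?_⟩
  · rw [isIrreducible_iff]
    refine ⟨e.symm.toEquiv.nontrivial, fun U hU => ?_⟩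
    have hU' (g : G) : U.comap e.toLinearMap ≤ (U.comap e.toLinearMap).comap (ρ g) := by
      intro v hv
      have := hU g (show e v ∈ U from hv)
      simpa [hσ] using this
    rcases hirr _ hU' with h | h
    · left
      rw [eq_bot_iff]
      intro u hu
      have : e.symm u ∈ U.comap e.toLinearMap := by simpa using hu
      rw [h] at this
      simpa using this
    · right
      rw [eq_top_iff]
      intro u _
      have : e.symm u ∈ U.comap e.toLinearMap := by rw [h]; trivial
      simpa using this
  · rw [codegree, hker, ← hm]
    have : (finrank ℂ V : ℚ) ≠ 0 := by exact_mod_cast finrank_pos.ne'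
    push_cast
    field_simp

theorem exists_rep_of_mem_codegrees {m : ℕ} (hm : m ∈ codegrees G) :
    ∃ (n : ℕ) (ρ : Representation ℂ G (Fin n → ℂ)), ρ.IsIrreducible ∧ 0 < n ∧
      m * n = (MonoidHom.ker ρ).index := by
  obtain ⟨n, ρ, hρ, h⟩ := hm
  have hn : 0 < n := by
    rcases Nat.eq_zero_or_pos n with rfl | h
    · obtain ⟨hV, -⟩ := isIrreducible_iff.1 hρ
      exact absurd hV (not_nontrivial _)
    · exact h
  refine ⟨n, ρ, hρ, hn, ?_⟩
  have hn' : (n : ℚ) ≠ 0 := by exact_mod_cast hn.ne'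
  rw [codegree, eq_div_iff hn'] at h
  exact_mod_cast h

theorem dvd_card_of_mem_codegrees {m : ℕ} (hm : m ∈ codegrees G) : m ∣ Nat.card G := by
  obtain ⟨n, ρ, -, -, h⟩ := exists_rep_of_mem_codegrees hm
  exact (Dvd.intro _ h).trans (MonoidHom.ker ρ).index_dvd_card

theorem codegrees_subset_of_surjective {f : G →* H} (hf : Function.Surjective f) :
    codegrees H ⊆ codegrees G := by
  rintro m ⟨n, ρ, hρ, h⟩
  refine ⟨n, ρ.comp f, ?_, ?_⟩
  · rw [isIrreducible_iff] at hρ ⊢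
    refine ⟨hρ.1, fun U hU => hρ.2 U fun g => ?_⟩
    obtain ⟨x, rfl⟩ := hf g
    exact hU x
  · rw [h, codegree, codegree, ← MonoidHom.comap_ker, Subgroup.index_comap_of_surjective _ hf]

/-- The right regular representation on functions. -/
def rightRegular (G : Type*) [Group G] : Representation ℂ G (G → ℂ) where
  toFun g := LinearMap.funLeft ℂ ℂ (· * g)
  map_one' := by ext; simp [LinearMap.funLeft]
  map_mul' x y := by
    refine LinearMap.ext fun f => funext fun t => ?_
    simp [LinearMap.funLeft, mul_assoc]

theorem rightRegular_apply (g : G) (f : G → ℂ) (x : G) : rightRegular G g f x = f (x * g) := rfl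

variable [Finite G]

/-- An irreducible representation of `G` that contains a faithful weight of a self-centralizing
cyclic normal subgroup `C` is faithful and of dimension `|G : C|`. -/
theorem card_mul_finrank_eq_index_ker [FiniteDimensional ℂ V] {ρ : Representation ℂ G V}
    (hρ : ρ.IsIrreducible) {c : G} [hc : (Subgroup.zpowers c).Normal]
    (hcent : Subgroup.centralizer {c} ≤ Subgroup.zpowers c) {z : ℂ} {w : V} (hw : w ≠ 0)
    (hz : orderOf z = orderOf c) (hzw : ρ c w = z • w) :
    Nat.card (Subgroup.zpowers c) * finrank ℂ V = (MonoidHom.ker ρ).index := by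
  have hfin : IsOfFinOrder z := orderOf_pos_iff.1 (hz ▸ orderOf_pos c)
  have hpow (k : ℕ) : ρ (c ^ k) w = z ^ k • w := by
    induction k with
    | zero => simp
    | succ k ih => rw [pow_succ, map_mul, Module.End.mul_apply, hzw, map_smul, ih, smul_smul,
        pow_succ, mul_comm]
  have hconj (g : G) : ∃ k : ℕ, g⁻¹ * c * g = c ^ k := by
    have := hc.conj_mem c (Subgroup.mem_zpowers c) g⁻¹
    rw [inv_inv, ← mem_powers_iff_mem_zpowers] at this
    obtain ⟨k, hk⟩ := this
    exact ⟨k, hk.symm⟩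
  choose k hk using hconj
  have hne (g : G) : ρ g w ≠ 0 := fun h => hw ((ρ.apply_bijective g).1 (by simpa using h))
  have heig (g : G) : ρ c (ρ g w) = z ^ k g • ρ g w := by
    rw [← map_smul, ← hpow, ← hk, ← Module.End.mul_apply, ← Module.End.mul_apply, ← map_mul,
      ← map_mul]
    congr 2
    group
  have hinj (x y : G) (h : z ^ k x = z ^ k y) : x⁻¹ * y ∈ Subgroup.zpowers c := by
    have h1 : c ^ k x = c ^ k y := by
      rwa [pow_eq_pow_iff_modEq, ← hz, ← hfin.pow_eq_pow_iff_modEq]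
    rw [← hk, ← hk] at h1
    have h2 : y * x⁻¹ ∈ Subgroup.zpowers c := by
      apply hcent
      rw [Subgroup.mem_centralizer_singleton_iff]
      calc y * x⁻¹ * c = y * (x⁻¹ * c * x) * x⁻¹ := by group
        _ = c * (y * x⁻¹) := by rw [h1]; group
    exact hc.mem_comm h2
  -- By `hinj`, distinct cosets give eigenvectors of `c` with distinct eigenvalues. Their span is
  -- invariant, so they form a basis of `V`.
  let v : G ⧸ Subgroup.zpowers c → V := fun x => ρ x.out w
  have hli : LinearIndependent ℂ v := by
    refine Module.End.eigenvectors_linearIndependent' (ρ c) (fun x => z ^ k x.out) ?_ v ?_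
    · intro x y h
      have := hinj _ _ h
      rw [← QuotientGroup.eq, QuotientGroup.out_eq', QuotientGroup.out_eq'] at this
      exact this
    · intro x
      exact ⟨Module.End.mem_eigenspace_iff.2 (heig _), hne _⟩
  have hspan : Submodule.span ℂ (Set.range v) = ⊤ := by
    refine ((isIrreducible_iff.1 hρ).2 _ fun g => ?_).resolve_left ?_
    · rw [Submodule.span_le]
      rintro _ ⟨x, rfl⟩
      let y : G ⧸ Subgroup.zpowers c := QuotientGroup.mk (g * x.out)
      have h1 : y.out⁻¹ * (g * x.out) ∈ Subgroup.zpowers c := by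
        rw [← QuotientGroup.eq, QuotientGroup.out_eq']
      rw [← mem_powers_iff_mem_zpowers] at h1
      obtain ⟨j, hj⟩ := h1
      have h2 : ρ g (v x) = z ^ j • v y := by
        rw [← map_smul, ← hpow, ← Module.End.mul_apply, ← Module.End.mul_apply, ← map_mul,
          ← map_mul]
        simp only at hj
        rw [hj]
        congr 2
        group
      rw [SetLike.mem_coe, Submodule.mem_comap, h2]
      exact Submodule.smul_mem _ _ (Submodule.subset_span ⟨y, rfl⟩)
    · intro h
      have : v (QuotientGroup.mk 1) ∈ Submodule.span ℂ (Set.range v) :=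
        Submodule.subset_span ⟨_, rfl⟩
      rw [h, Submodule.mem_bot] at this
      exact hne _ this
  have := Fintype.ofFinite (G ⧸ Subgroup.zpowers c)
  have hdim : finrank ℂ V = (Subgroup.zpowers c).index := by
    rw [finrank_eq_card_basis (Basis.mk hli hspan.ge), Fintype.card_eq_nat_card]
    rfl
  -- The kernel meets `⟨c⟩` trivially. Commutators of its elements with `c` lie in both, so it
  -- centralizes `c` and lies in `⟨c⟩`.
  have hker : MonoidHom.ker ρ = ⊥ := by
    rw [eq_bot_iff]
    have hdis : ∀ x ∈ Subgroup.zpowers c, x ∈ MonoidHom.ker ρ → x = 1 := by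
      intro x hx hxk
      rw [← mem_powers_iff_mem_zpowers] at hx
      obtain ⟨j, rfl⟩ := hx
      have h1 := hpow j
      rw [MonoidHom.mem_ker] at hxk
      simp only at hxk
      rw [hxk, Module.End.one_apply] at h1
      have h2 : (z ^ j - 1) • w = 0 := by rw [sub_smul, ← h1, one_smul, sub_self]
      have h3 := sub_eq_zero.1 ((smul_eq_zero.1 h2).resolve_right hw)
      rw [← orderOf_dvd_iff_pow_eq_one, hz] at h3
      exact orderOf_dvd_iff_pow_eq_one.1 h3
    intro g hg
    refine hdis g (hcent ?_) hg
    rw [Subgroup.mem_centralizer_singleton_iff]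
    have h1 : g * c * g⁻¹ * c⁻¹ = 1 := by
      apply hdis
      · exact mul_mem (hc.conj_mem _ (Subgroup.mem_zpowers c) g)
          (inv_mem (Subgroup.mem_zpowers c))
      · rw [mul_assoc, mul_assoc, ← mul_assoc c]
        exact mul_mem hg ((MonoidHom.normal_ker ρ).conj_mem _ (inv_mem hg) c)
    rwa [mul_inv_eq_one, mul_inv_eq_iff_eq_mul] at h1
  rw [hdim, hker, Subgroup.index_bot, Subgroup.card_mul_index]

/-- The functions with `f (c * x) = ζ * f x` form the representation induced from a faithful
character of `⟨c⟩`. A minimal nonzero invariant subspace is irreducible. As `⟨c⟩` is normal, every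
eigenvalue of `c` on it is a conjugate power `ζ ^ k`, of the same order as `ζ`. -/
theorem exists_isIrreducible_with_eigenvector (c : G) [hc : (Subgroup.zpowers c).Normal] :
    ∃ (U : Submodule ℂ (G → ℂ)) (ρ : Representation ℂ G U) (z : ℂ) (w : U),
      ρ.IsIrreducible ∧ w ≠ 0 ∧ orderOf z = orderOf c ∧ ρ c w = z • w := by
  classical
  obtain ⟨ζ, hζ⟩ : ∃ ζ : ℂ, orderOf ζ = orderOf c :=
    ⟨_, (Complex.isPrimitiveRoot_exp _ (orderOf_pos c).ne').eq_orderOf.symm⟩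
  have hfin : IsOfFinOrder ζ := orderOf_pos_iff.1 (hζ ▸ orderOf_pos c)
  let S : Set (Submodule ℂ (G → ℂ)) := {U | U ≠ ⊥ ∧ (∀ g, U ≤ U.comap (rightRegular G g)) ∧
    ∀ f ∈ U, ∀ x, f (c * x) = ζ * f x}
  have hS : S.Nonempty := by
    refine ⟨⨅ x : G, LinearMap.ker (LinearMap.proj (c * x) - ζ • LinearMap.proj (φ := fun _ => ℂ) x :
        (G → ℂ) →ₗ[ℂ] ℂ), ?_, ?_, ?_⟩
    -- The character `c ^ k ↦ ζ ^ k` extended by zero; the chosen exponent is immaterial because `ζ`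
    -- and `c` have equal order.
    · let f : G → ℂ := fun x => if h : ∃ k : ℕ, c ^ k = x then ζ ^ h.choose else 0
      have hf (k : ℕ) : f (c ^ k) = ζ ^ k := by
        have h : ∃ j : ℕ, c ^ j = c ^ k := ⟨k, rfl⟩
        have h1 : f (c ^ k) = ζ ^ h.choose := dif_pos h
        rw [h1, hfin.pow_eq_pow_iff_modEq, hζ, ← pow_eq_pow_iff_modEq]
        exact h.choose_spec
      rw [Submodule.ne_bot_iff]
      refine ⟨f, ?_, fun h => ?_⟩
      · simp only [Submodule.mem_iInf, LinearMap.mem_ker]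
        intro x
        by_cases hx : x ∈ Submonoid.powers c
        · obtain ⟨k, rfl⟩ := hx
          simp [← pow_succ', hf]
        · have hx' : c * x ∉ Submonoid.powers c := by
            rw [mem_powers_iff_mem_zpowers] at hx ⊢
            rwa [Subgroup.mul_mem_cancel_left _ (Subgroup.mem_zpowers c)]
          have h1 : f x = 0 := dif_neg hx
          have h2 : f (c * x) = 0 := dif_neg hx'
          simp [h1, h2]
      · have h1 := hf 0
        rw [h] at h1
        simp at h1
    · intro g f hf
      simp only [Submodule.mem_iInf, LinearMap.mem_ker, Submodule.mem_comap] at hf ⊢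
      intro x
      have := hf (x * g)
      simpa [rightRegular_apply, mul_assoc] using this
    · intro f hf x
      simp only [Submodule.mem_iInf, LinearMap.mem_ker] at hf
      have := hf x
      simpa [sub_eq_zero] using this
  obtain ⟨U, ⟨hU0, hUinv, hUc⟩, hmin⟩ := wellFounded_lt.has_min S hS
  let ρ : Representation ℂ G U := (rightRegular G).subrepresentation U hUinv
  have hρ (g : G) (f : U) : (ρ g f : G → ℂ) = rightRegular G g f := rfl
  have hnt : Nontrivial U := (Submodule.nontrivial_iff_ne_bot).2 hU0
  obtain ⟨z, hz⟩ := Module.End.exists_eigenvalue (ρ c)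
  obtain ⟨w, hw⟩ := hz.exists_hasEigenvector
  refine ⟨U, ρ, z, w, ?_, hw.2, ?_, hw.apply_eq_smul⟩
  · rw [isIrreducible_iff]
    refine ⟨hnt, fun T hT => or_iff_not_imp_left.2 fun hT0 => ?_⟩
    have h1 : T.map U.subtype ∈ S := by
      refine ⟨?_, ?_, ?_⟩
      · intro h
        exact hT0 (Submodule.map_injective_of_injective U.subtype_injective
          (h.trans (Submodule.map_bot _).symm))
      · rintro g _ ⟨f, hf, rfl⟩
        exact ⟨ρ g f, hT g hf, rfl⟩
      · rintro _ ⟨f, hf, rfl⟩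
        exact hUc _ f.2
    have h2 := hmin _ h1
    have h3 : T.map U.subtype ≤ U := Submodule.map_subtype_le U T
    have h4 : T.map U.subtype = U := by
      by_contra h
      exact h2 (lt_of_le_of_ne h3 h)
    rw [eq_top_iff]
    intro f _
    have h5 : (f : G → ℂ) ∈ T.map U.subtype := by rw [h4]; exact f.2
    obtain ⟨f', hf', h6⟩ := h5
    rwa [← Subtype.ext h6]
  · have hw0 : (w : G → ℂ) ≠ 0 := fun h => hw.2 (Subtype.ext h)
    obtain ⟨g, hg⟩ := Function.ne_iff.1 hw0
    have h1 : (w : G → ℂ) (g * c) = z * (w : G → ℂ) g := by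
      have := congrArg (fun f : U => (f : G → ℂ) g) hw.apply_eq_smul
      simpa [hρ, rightRegular_apply] using this
    have h2 := hc.conj_mem c (Subgroup.mem_zpowers c) g
    rw [← mem_powers_iff_mem_zpowers] at h2
    obtain ⟨k, hk⟩ := h2
    simp only at hk
    have h3 (j : ℕ) : (w : G → ℂ) (c ^ j * g) = ζ ^ j * (w : G → ℂ) g := by
      induction j with
      | zero => simp
      | succ j ih => rw [pow_succ', mul_assoc, hUc _ w.2, ih, pow_succ', mul_assoc]
    have h4 := h3 k
    rw [hk, inv_mul_cancel_right, h1] at h4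
    have h5 : z = ζ ^ k := mul_right_cancel₀ hg h4
    rw [h5, hfin.orderOf_pow, hζ, ← orderOf_pow, hk]
    exact (MulAut.conj g).orderOf_eq c

/-- The centralizer of an abelian normal subgroup with cyclic quotient gives a codegree. -/
theorem card_centralizer_mem_codegrees (hG : Squarefree (Nat.card G)) (A : Subgroup G) [A.Normal]
    [IsCyclic (G ⧸ A)] (hA : A ≤ Subgroup.centralizer A) :
    Nat.card (Subgroup.centralizer (A : Set G)) ∈ codegrees G := by
  have hZ := IsZGroup.of_squarefree hG
  set C := Subgroup.centralizer (A : Set G) with hC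
  -- `A` is central in `C` and `C / A` embeds in the cyclic group `G / A`, so `C` is abelian; an
  -- abelian Z-group is cyclic.
  have hcomm : IsMulCommutative C := by
    let f := ((QuotientGroup.mk' A).comp C.subtype).rangeRestrict
    refine f.isMulCommutative_of_isCyclic_of_ker_le_center ?_
    intro x hx
    rw [MonoidHom.ker_rangeRestrict, ← MonoidHom.comap_ker, QuotientGroup.ker_mk'] at hx
    rw [Subgroup.mem_center_iff]
    intro y
    exact Subtype.ext (Subgroup.mem_centralizer_iff.1 y.2 x hx).symm
  have hcyc : IsCyclic C := by
    open scoped IsMulCommutative in infer_instance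
  obtain ⟨c, hc⟩ := hcyc.exists_zpow_surjective
  have hCc : Subgroup.zpowers (c : G) = C := by
    ext x
    constructor
    · rintro ⟨k, rfl⟩
      exact zpow_mem c.2 k
    · intro hx
      obtain ⟨k, hk⟩ := hc ⟨x, hx⟩
      exact ⟨k, by simpa using congrArg Subtype.val hk⟩
  have hn : (Subgroup.zpowers (c : G)).Normal := by rw [hCc]; infer_instance
  obtain ⟨U, ρ, z, w, hρ, hw, hz, hzw⟩ := exists_isIrreducible_with_eigenvector (c : G)
  rw [← hCc]
  refine mem_codegrees_of_isIrreducible hρ (card_mul_finrank_eq_index_ker hρ ?_ hw hz hzw)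
  rw [hCc]
  intro g hg
  rw [hC, Subgroup.mem_centralizer_iff]
  intro a ha
  have ha' : a ∈ Subgroup.zpowers (c : G) := by rw [hCc]; exact hA ha
  obtain ⟨k, rfl⟩ := ha'
  rw [Subgroup.mem_centralizer_singleton_iff] at hg
  exact (Commute.zpow_right (show Commute g c from hg) k).symm.eq

end Representations

end CodegreeGraph

namespace CodegreeGraph

open Module

/-! ### Vanishing characters and excluded edges. -/

section NonAdjacent

variable {G : Type*} [Group G] [Finite G]

/-- The character of `b` vanishes if `b` does not commute with a generator `a` of a normal
subgroup of prime order that is not contained in the kernel. -/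
theorem character_eq_zero_of_not_commute {V : Type*} [AddCommGroup V] [Module ℂ V]
    {ρ : Representation ℂ G V} (hρ : ρ.IsIrreducible) {a b : G} (ha : (orderOf a).Prime)
    [hn : (Subgroup.zpowers a).Normal] (hker : a ∉ MonoidHom.ker ρ) (hab : ¬ Commute a b) :
    ρ.character b = 0 := by
  -- The fixed space of the normal subgroup `⟨a⟩` is `G`-invariant.
  have hfix : LinearMap.ker (ρ a - 1) = ⊥ := by
    refine ((isIrreducible_iff.1 hρ).2 _ fun g v hv => ?_).resolve_right fun h => hker ?_
    · rw [LinearMap.mem_ker, LinearMap.sub_apply, Module.End.one_apply, sub_eq_zero] at hv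
      rw [Submodule.mem_comap, LinearMap.mem_ker, LinearMap.sub_apply, Module.End.one_apply,
        sub_eq_zero]
      have h1 := hn.conj_mem a (Subgroup.mem_zpowers a) g⁻¹
      rw [← mem_powers_iff_mem_zpowers] at h1
      obtain ⟨k, hk⟩ := h1
      simp only [inv_inv] at hk
      have h2 : ρ (a ^ k) v = v := by
        rw [map_pow, Module.End.pow_apply]
        exact Function.iterate_fixed hv k
      calc ρ a (ρ g v) = ρ (g * a ^ k) v := by
            rw [hk, ← Module.End.mul_apply, ← map_mul]; congr 2; group
        _ = ρ g v := by rw [map_mul, Module.End.mul_apply, h2]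
    · rw [LinearMap.ker_eq_top, sub_eq_zero] at h
      exact h
  -- `s` generates `⟨a⟩`, and conjugating `b` by `a ^ i` gives `b * s ^ i`. All these have the same
  -- trace, while `∑ ρ s ^ i` vanishes because `s` fixes no nonzero vector.
  obtain ⟨s, hs⟩ : ∃ s, s = b⁻¹ * a * b * a⁻¹ := ⟨_, rfl⟩
  have hsa : s ∈ Subgroup.zpowers a := by
    rw [hs]
    refine mul_mem ?_ (inv_mem (Subgroup.mem_zpowers a))
    simpa using hn.conj_mem a (Subgroup.mem_zpowers a) b⁻¹
  have hs1 : s ≠ 1 := by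
    rintro h
    rw [hs, mul_inv_eq_one, mul_assoc, inv_mul_eq_iff_eq_mul] at h
    exact hab h
  have hcomm : Commute a s := by
    obtain ⟨k, rfl⟩ := hsa
    exact Commute.zpow_right (Commute.refl a) k
  have has : a ∈ Subgroup.zpowers s := by
    have h1 : Subgroup.zpowers s ≤ Subgroup.zpowers a := by simpa using hsa
    have h2 : Nat.card (Subgroup.zpowers s) = Nat.card (Subgroup.zpowers a) := by
      have h3 := Subgroup.card_dvd_of_le h1
      rw [Nat.card_zpowers, Nat.card_zpowers] at h3 ⊢
      exact ((Nat.dvd_prime ha).1 h3).resolve_left (by rwa [orderOf_eq_one_iff])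
    rw [Subgroup.eq_of_le_of_card_ge h1 h2.ge]
    exact Subgroup.mem_zpowers a
  have hsfix : LinearMap.ker (ρ s - 1) = ⊥ := by
    rw [eq_bot_iff, ← hfix]
    intro v hv
    rw [LinearMap.mem_ker, LinearMap.sub_apply, Module.End.one_apply, sub_eq_zero] at hv ⊢
    rw [← mem_powers_iff_mem_zpowers] at has
    obtain ⟨k, rfl⟩ := has
    simp only [map_pow, Module.End.pow_apply]
    exact Function.iterate_fixed hv k
  have hsum : ∑ i ∈ Finset.range (orderOf s), ρ s ^ i = 0 := by
    have h1 : (ρ s - 1) * ∑ i ∈ Finset.range (orderOf s), ρ s ^ i = 0 := by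
      rw [mul_geom_sum, ← map_pow, pow_orderOf_eq_one, map_one, sub_self]
    refine LinearMap.ext fun v => ?_
    have h2 := LinearMap.congr_fun h1 v
    rw [Module.End.mul_apply] at h2
    exact (LinearMap.ker_eq_bot.1 hsfix) (by simpa using h2)
  have hconj (i : ℕ) : a ^ i * b * (a ^ i)⁻¹ = b * s ^ i := by
    induction i with
    | zero => simp
    | succ i ih =>
      calc a ^ (i + 1) * b * (a ^ (i + 1))⁻¹ = a * (a ^ i * b * (a ^ i)⁻¹) * a⁻¹ := by
            rw [pow_succ']; group
        _ = a * b * (s ^ i * a⁻¹) := by rw [ih]; group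
        _ = a * b * (a⁻¹ * s ^ i) := by rw [((hcomm.inv_left).pow_right i).eq]
        _ = b * s * s ^ i := by rw [hs]; group
        _ = b * s ^ (i + 1) := by rw [pow_succ', mul_assoc]
  have hchar (i : ℕ) : LinearMap.trace ℂ V (ρ b * ρ s ^ i) = ρ.character b := by
    rw [← map_pow, ← map_mul, ← hconj]
    exact ρ.char_conj b (a ^ i)
  have h1 : LinearMap.trace ℂ V (ρ b * ∑ i ∈ Finset.range (orderOf s), ρ s ^ i) =
      orderOf s * ρ.character b := by
    rw [Finset.mul_sum, map_sum, Finset.sum_congr rfl fun i _ => hchar i]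
    simp
  rw [hsum, mul_zero, map_zero] at h1
  exact (mul_eq_zero.1 h1.symm).resolve_left (by exact_mod_cast (orderOf_pos s).ne')

/-- Averaging the character over `⟨b⟩` gives the dimension of the invariants, and only the identity
contributes. -/
theorem orderOf_dvd_finrank_of_character_eq_zero {V : Type*} [AddCommGroup V] [Module ℂ V]
    [FiniteDimensional ℂ V] {ρ : Representation ℂ G V} {b : G}
    (h : ∀ x ∈ Subgroup.zpowers b, x ≠ 1 → ρ.character x = 0) : orderOf b ∣ finrank ℂ V := by
  have := Fintype.ofFinite (Subgroup.zpowers b)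
  let σ : Representation ℂ (Subgroup.zpowers b) V := ρ.comp (Subgroup.zpowers b).subtype
  have h0 : (Nat.card (Subgroup.zpowers b) : ℂ) ≠ 0 := by exact_mod_cast Nat.card_pos.ne'
  have := invertibleOfNonzero h0
  have h1 := σ.card_inv_mul_sum_char_eq_finrank
  have h2 (x : Subgroup.zpowers b) (hx : x ≠ 1) : σ.character x = 0 :=
    h x x.2 (by simpa using hx)
  rw [Finset.sum_eq_single 1 (fun x _ hx => h2 x hx) (by simp),
    Representation.char_one, inv_mul_eq_iff_eq_mul₀ h0, Nat.card_zpowers] at h1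
  exact Dvd.intro _ (by exact_mod_cast h1.symm)

/-- Square-freeness keeps `a` out of the kernel, so the character vanishes on `⟨b⟩` off the identity
and `orderOf b` divides the degree. Dividing the codegree as well, its square divides the index of
the kernel. -/
theorem not_dvd_of_mem_codegrees (hG : Squarefree (Nat.card G)) {a b : G}
    (ha : (orderOf a).Prime) (hb : (orderOf b).Prime) [(Subgroup.zpowers a).Normal]
    (hab : ¬ Commute a b) {m : ℕ} (hm : m ∈ codegrees G) : ¬ orderOf b * orderOf a ∣ m := by
  intro hdvd
  obtain ⟨n, ρ, hρ, -, hmn⟩ := exists_rep_of_mem_codegrees hm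
  have hcard := (MonoidHom.ker ρ).index_mul_card
  have hsq {p k : ℕ} (hp : p.Prime) (hk : p * p ∣ k) (hkG : k ∣ Nat.card G) : False :=
    hp.one_lt.ne' (Nat.isUnit_iff.1 (hG p (hk.trans hkG)))
  have hker : a ∉ MonoidHom.ker ρ := by
    intro h
    have h1 : orderOf a ∣ Nat.card (MonoidHom.ker ρ) := Subgroup.orderOf_dvd_natCard _ h
    have h2 : orderOf a ∣ (MonoidHom.ker ρ).index :=
      hmn ▸ ((Dvd.intro_left _ rfl).trans hdvd).mul_right n
    exact hsq ha (mul_dvd_mul h2 h1) hcard.dvd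
  have hchar : ∀ x ∈ Subgroup.zpowers b, x ≠ 1 → ρ.character x = 0 := by
    intro x hx hx1
    refine character_eq_zero_of_not_commute hρ ha hker fun hax => hab ?_
    have h1 : Subgroup.zpowers x ≤ Subgroup.zpowers b := by simpa using hx
    have h2 : Nat.card (Subgroup.zpowers x) = Nat.card (Subgroup.zpowers b) := by
      have h3 := Subgroup.card_dvd_of_le h1
      rw [Nat.card_zpowers, Nat.card_zpowers] at h3 ⊢
      exact ((Nat.dvd_prime hb).1 h3).resolve_left (by rwa [orderOf_eq_one_iff])
    have h3 : b ∈ Subgroup.zpowers x := by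
      rw [Subgroup.eq_of_le_of_card_ge h1 h2.ge]
      exact Subgroup.mem_zpowers b
    obtain ⟨k, rfl⟩ := h3
    exact hax.zpow_right k
  have h1 := orderOf_dvd_finrank_of_character_eq_zero hchar
  rw [finrank_fin_fun] at h1
  refine hsq hb ?_ (MonoidHom.ker ρ).index_dvd_card
  rw [← hmn]
  exact mul_dvd_mul ((Dvd.intro _ rfl).trans hdvd) h1

end NonAdjacent

/-! ### The two cliques in square-free order. -/

section Cliques

variable {G : Type*} [Group G] [Finite G]

theorem card_commutator_dvd_mem_codegrees (hG : Squarefree (Nat.card G)) :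
    ∃ m ∈ codegrees G, Nat.card (commutator G) ∣ m := by
  have hZ := IsZGroup.of_squarefree hG
  have : IsCyclic (G ⧸ commutator G) := IsZGroup.isCyclic_abelianization (G := G)
  have hcyc : IsCyclic (commutator G) := IsZGroup.isCyclic_commutator G
  have hle : commutator G ≤ Subgroup.centralizer (commutator G) := by
    intro x hx
    rw [Subgroup.mem_centralizer_iff]
    intro y hy
    have := hcyc.isMulCommutative.is_comm.comm ⟨y, hy⟩ ⟨x, hx⟩
    exact congrArg Subtype.val this
  exact ⟨_, card_centralizer_mem_codegrees hG _ hle, Subgroup.card_dvd_of_le hle⟩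

theorem card_mem_codegrees_of_isCyclic [IsCyclic G] (hG : Squarefree (Nat.card G)) :
    Nat.card G ∈ codegrees G := by
  have h : Subgroup.centralizer ((⊤ : Subgroup G) : Set G) = ⊤ := by
    rw [eq_top_iff]
    intro x _
    rw [Subgroup.mem_centralizer_iff]
    exact fun y _ => (inferInstance : IsCyclic G).isMulCommutative.is_comm.comm y x
  have := QuotientGroup.subsingleton_quotient_top (G := G)
  have : IsCyclic (G ⧸ (⊤ : Subgroup G)) := isCyclic_of_subsingleton
  have h1 := card_centralizer_mem_codegrees hG ⊤ h.ge
  rwa [h, Subgroup.card_top] at h1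

theorem index_commutator_mem_codegrees (hG : Squarefree (Nat.card G)) :
    (commutator G).index ∈ codegrees G := by
  have hZ := IsZGroup.of_squarefree hG
  have : IsCyclic (G ⧸ commutator G) := IsZGroup.isCyclic_abelianization (G := G)
  refine codegrees_subset_of_surjective (QuotientGroup.mk'_surjective (commutator G))
    (card_mem_codegrees_of_isCyclic (G := G ⧸ commutator G) ?_)
  exact hG.squarefree_of_dvd (commutator G).index_dvd_card

/-- The complement of the codegree prime graph of a finite group of square-free order is
coloured according to whether a prime divides the order of the commutator subgroup. -/
theorem compl_codegreePrimeGraph_colorable (hG : Squarefree (Nat.card G)) :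
    (codegreePrimeGraph G)ᶜ.Colorable 2 := by
  classical
  have key (p q : Vertex G) (hpq : p ≠ q)
      (h : p.1 ∣ Nat.card (commutator G) ↔ q.1 ∣ Nat.card (commutator G)) :
      (codegreePrimeGraph G).Adj p q := by
    have hcop : Nat.Coprime p.1 q.1 :=
      (Nat.coprime_primes p.2.1 q.2.1).2 fun h => hpq (Subtype.ext h)
    have hdvd (r : Vertex G) : r.1 ∣ Nat.card (commutator G) * (commutator G).index := by
      obtain ⟨-, m, hm, hr⟩ := r.2
      rw [Subgroup.card_mul_index]
      exact hr.trans (dvd_card_of_mem_codegrees hm)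
    refine ⟨hpq, ?_⟩
    by_cases hp : p.1 ∣ Nat.card (commutator G)
    · obtain ⟨m, hm, hm'⟩ := card_commutator_dvd_mem_codegrees hG
      exact ⟨m, hm, (hcop.mul_dvd_of_dvd_of_dvd hp (h.1 hp)).trans hm'⟩
    · refine ⟨_, index_commutator_mem_codegrees hG, hcop.mul_dvd_of_dvd_of_dvd ?_ ?_⟩
      · exact (p.2.1.dvd_mul.1 (hdvd p)).resolve_left hp
      · exact (q.2.1.dvd_mul.1 (hdvd q)).resolve_left (mt h.2 hp)
  let C : (codegreePrimeGraph G)ᶜ.Coloring Bool :=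
    SimpleGraph.Coloring.mk (fun p => decide (p.1 ∣ Nat.card (commutator G))) (by
      intro p q hpq hcol
      rw [SimpleGraph.compl_adj] at hpq
      exact hpq.2 (key p q hpq.1 (by simpa using hcol)))
  simpa using C.colorable

end Cliques

end CodegreeGraph

namespace CodegreeGraph

/-! ### Affine groups over `ℤ/N`. -/

section AffineGroup

variable {R S B : Type*} [CommRing R] [CommRing S] [Group B]

/-- The action on the additive group of a ring by multiplication with units. -/
def affineAction (θ : B →* Rˣ) : B →* MulAut (Multiplicative R) where
  toFun b := AddEquiv.toMultiplicative (DistribMulAction.toAddEquiv R (θ b))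
  map_one' := by ext x; simp
  map_mul' x y := by ext z; simp [mul_smul]

theorem affineAction_ofAdd (θ : B →* Rˣ) (b : B) (r : R) :
    affineAction θ b (Multiplicative.ofAdd r) = Multiplicative.ofAdd ((θ b : R) * r) := rfl

/-- The affine group `R ⋊ B`, where `B` acts by multiplication with units. -/
abbrev AffineGroup (θ : B →* Rˣ) : Type _ := Multiplicative R ⋊[affineAction θ] B

theorem card_affineGroup (θ : B →* Rˣ) :
    Nat.card (AffineGroup θ) = Nat.card R * Nat.card B := by
  rw [SemidirectProduct.card]
  rfl

instance [Finite R] [Finite B] (θ : B →* Rˣ) : Finite (AffineGroup θ) :=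
  Finite.of_equiv _ SemidirectProduct.equivProd.symm

/-- The codegree is the order of the centralizer of the translation subgroup, which contains the
translations and the kernel of `θ`. -/
theorem exists_mem_codegrees_affineGroup [Finite R] [Finite B] [IsCyclic B] (θ : B →* Rˣ)
    (h : Squarefree (Nat.card R * Nat.card B)) :
    ∃ m ∈ codegrees (AffineGroup θ), Nat.card R ∣ m ∧ ∀ b : B, θ b = 1 → orderOf b ∣ m := by
  let A : Subgroup (AffineGroup θ) := (SemidirectProduct.inl).range
  have hA : A = SemidirectProduct.rightHom.ker := SemidirectProduct.range_inl_eq_ker_rightHom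
  have hn : A.Normal := by rw [hA]; infer_instance
  have hcyc : IsCyclic (AffineGroup θ ⧸ A) := by
    let e : B ≃* AffineGroup θ ⧸ A :=
      (QuotientGroup.quotientKerEquivOfSurjective (SemidirectProduct.rightHom (φ := affineAction θ))
        SemidirectProduct.rightHom_surjective).symm.trans
          (QuotientGroup.quotientMulEquivOfEq hA.symm)
    exact isCyclic_of_surjective e e.surjective
  have hle : A ≤ Subgroup.centralizer A := by
    rintro _ ⟨x, rfl⟩
    rw [Subgroup.mem_centralizer_iff]
    rintro _ ⟨y, rfl⟩
    rw [← map_mul, ← map_mul, mul_comm]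
  refine ⟨_, card_centralizer_mem_codegrees (by rwa [card_affineGroup]) A hle, ?_, ?_⟩
  · refine dvd_trans (dvd_of_eq ?_) (Subgroup.card_dvd_of_le hle)
    exact Nat.card_congr 
      (MonoidHom.ofInjective (SemidirectProduct.inl_injective (φ := affineAction θ))).toEquiv
  · intro b hb
    rw [← orderOf_injective _ (SemidirectProduct.inr_injective (φ := affineAction θ)) b]
    refine Subgroup.orderOf_dvd_natCard _ ?_
    rw [Subgroup.mem_centralizer_iff]
    rintro _ ⟨x, rfl⟩
    have h1 : affineAction θ b x = x := by
      have := affineAction_ofAdd θ b x.toAdd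
      rwa [hb, Units.val_one, one_mul] at this
    have h2 := SemidirectProduct.inl_aut (φ := affineAction θ) b x
    rw [h1, map_inv, eq_mul_inv_iff_mul_eq] at h2
    exact h2

theorem codegrees_affineGroup_map_subset (θ : B →* Rˣ) {f : R →+* S}
    (hf : Function.Surjective f) :
    codegrees (AffineGroup ((Units.map (f : R →* S)).comp θ)) ⊆ codegrees (AffineGroup θ) := by
  let F : AffineGroup θ →* AffineGroup ((Units.map (f : R →* S)).comp θ) :=
    SemidirectProduct.map (AddMonoidHom.toMultiplicative f.toAddMonoidHom) (MonoidHom.id B) (by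
      intro b
      ext x
      exact map_mul f (θ b : R) x)
  refine codegrees_subset_of_surjective (f := F) fun x => ?_
  obtain ⟨r, hr⟩ := hf x.left.toAdd
  refine ⟨⟨Multiplicative.ofAdd r, x.right⟩, ?_⟩
  exact SemidirectProduct.ext hr rfl

variable {N M : ℕ} [NeZero N] [NeZero M]

/-- Passing to the quotient `ℤ/d ⋊ ℤ/M` enlarges the set of `b` that act trivially. -/
theorem exists_mem_codegrees_of_dvd (h : Squarefree (N * M))
    (θ : Multiplicative (ZMod M) →* (ZMod N)ˣ) {d : ℕ} (hd : d ∣ N) :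
    ∃ m ∈ codegrees (AffineGroup θ), d ∣ m ∧
      ∀ b, ZMod.castHom hd (ZMod d) (θ b : ZMod N) = 1 → orderOf b ∣ m := by
  have : NeZero d := ⟨fun h => NeZero.ne N (zero_dvd_iff.1 (h ▸ hd))⟩
  have h1 : Squarefree (Nat.card (ZMod d) * Nat.card (Multiplicative (ZMod M))) := by
    have : Nat.card (Multiplicative (ZMod M)) = M := Nat.card_zmod M
    rw [this, Nat.card_zmod]
    exact h.squarefree_of_dvd (Nat.mul_dvd_mul_right hd M)
  obtain ⟨m, hm, hdm, hb⟩ := exists_mem_codegrees_affineGroup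
    ((Units.map (ZMod.castHom hd (ZMod d) : ZMod N →* ZMod d)).comp θ) h1
  rw [Nat.card_zmod] at hdm
  refine ⟨m, codegrees_affineGroup_map_subset θ (ZMod.castHom_surjective hd) hm, hdm,
    fun b h => hb b (Units.ext h)⟩

theorem not_dvd_of_mem_codegrees_affineGroup (h : Squarefree (N * M))
    (θ : Multiplicative (ZMod M) →* (ZMod N)ˣ) {q : ℕ} (hq : q.Prime) (hqN : q ∣ N)
    {b : Multiplicative (ZMod M)} (hb : (orderOf b).Prime)
    (hθ : ZMod.castHom hqN (ZMod q) (θ b : ZMod N) ≠ 1)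
    {m : ℕ} (hm : m ∈ codegrees (AffineGroup θ)) : ¬ orderOf b * q ∣ m := by
  obtain ⟨t, rfl⟩ := hqN
  have ht : t ≠ 0 := fun h => NeZero.ne (q * t) (by simp [h])
  -- The translation by `t` has order `q`. It generates an ideal of `ℤ/(qt)`, hence a normal
  -- subgroup, and `b` commutes with it only if `θ b ≡ 1` modulo `q`.
  let a : AffineGroup θ := SemidirectProduct.inl (Multiplicative.ofAdd (t : ZMod (q * t)))
  have ha : orderOf a = q := by
    rw [orderOf_injective _ SemidirectProduct.inl_injective, orderOf_ofAdd_eq_addOrderOf,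
      ZMod.addOrderOf_coe _ (NeZero.ne _), Nat.gcd_eq_right (Dvd.intro_left _ rfl),
      Nat.mul_div_cancel _ (Nat.pos_of_ne_zero ht)]
  have hact (c : Multiplicative (ZMod M)) :
      affineAction θ c (Multiplicative.ofAdd (t : ZMod (q * t))) =
        Multiplicative.ofAdd (t : ZMod (q * t)) ^ (θ c : ZMod (q * t)).val := by
    rw [affineAction_ofAdd, ← ofAdd_nsmul, nsmul_eq_mul, ZMod.natCast_val, ZMod.cast_id]
  have hn : (Subgroup.zpowers a).Normal := by
    refine ⟨?_⟩
    rintro _ ⟨k, rfl⟩ g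
    have h1 : g * a * g⁻¹ ∈ Subgroup.zpowers a := by
      have h2 := SemidirectProduct.inl_aut (φ := affineAction θ) g.right
        (Multiplicative.ofAdd (t : ZMod (q * t)))
      rw [hact, map_pow, map_inv] at h2
      have h3 : g * a * g⁻¹ = SemidirectProduct.inl g.left *
          (SemidirectProduct.inr g.right * a * (SemidirectProduct.inr g.right)⁻¹) *
            (SemidirectProduct.inl g.left)⁻¹ := by
        conv_lhs => rw [← SemidirectProduct.inl_left_mul_inr_right g]
        group
      rw [h3, ← h2, ← map_pow, ← map_inv, ← map_mul, ← map_mul, mul_inv_cancel_comm, map_pow]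
      exact pow_mem (Subgroup.mem_zpowers a) _
    simp only
    rw [← conj_zpow]
    exact zpow_mem h1 k
  have hbo := orderOf_injective _ (SemidirectProduct.inr_injective (φ := affineAction θ)) b
  rw [← ha, ← hbo]
  refine not_dvd_of_mem_codegrees (by rwa [card_affineGroup, Nat.card_zmod,
    show Nat.card (Multiplicative (ZMod M)) = M from Nat.card_zmod M]) (by rwa [ha])
    (by rwa [hbo]) ?_ hm
  intro hcomm
  have h1 := SemidirectProduct.inl_aut (φ := affineAction θ) b
    (Multiplicative.ofAdd (t : ZMod (q * t)))
  rw [map_inv, ← hcomm.eq, mul_inv_cancel_right, SemidirectProduct.inl_inj, affineAction_ofAdd,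
    Multiplicative.ofAdd.apply_eq_iff_eq] at h1
  refine hθ ?_
  set x := (θ b : ZMod (q * t))
  have hx : ((x.val : ℤ) : ZMod (q * t)) = x := by simp
  rw [← sub_eq_zero, ← sub_one_mul, ← hx, ← Int.cast_one, ← Int.cast_sub, ← Int.cast_natCast t,
    ← Int.cast_mul, ZMod.intCast_zmod_eq_zero_iff_dvd, Nat.cast_mul] at h1
  have h2 : (q : ℤ) ∣ (x.val : ℤ) - 1 :=
    Int.dvd_of_mul_dvd_mul_right (by exact_mod_cast ht) h1
  rw [← ZMod.intCast_zmod_eq_zero_iff_dvd, Int.cast_sub, sub_eq_zero] at h2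
  rw [← hx, map_intCast, h2, Int.cast_one]

end AffineGroup

end CodegreeGraph

namespace CodegreeGraph

/-! ### Choice of primes and units. -/

section Arithmetic

theorem exists_injective_mem_of_infinite {ι : Type*} [Finite ι] (S : ι → Set ℕ)
    (hS : ∀ i, (S i).Infinite) : ∃ f : ι → ℕ, Function.Injective f ∧ ∀ i, f i ∈ S i := by
  have := Fintype.ofFinite ι
  choose t ht hcard using fun i => (hS i).exists_subset_card_eq (Fintype.card ι)
  obtain ⟨f, hf, h⟩ := (Finset.all_card_le_biUnion_card_iff_exists_injective t).1 (by
    intro s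
    rcases s.eq_empty_or_nonempty with rfl | ⟨i, hi⟩
    · simp
    · calc s.card ≤ Fintype.card ι := s.card_le_univ
        _ = (t i).card := (hcard i).symm
        _ ≤ _ := Finset.card_le_card (Finset.subset_biUnion_of_mem t hi))
  exact ⟨f, hf, fun i => ht i (h i)⟩

theorem exists_prime_labelling {V : Type*} [Fintype V] (c : V → Prop) [DecidablePred c]
    (r : V → V → Prop) [DecidableRel r] :
    ∃ l : V → ℕ, Function.Injective l ∧ (∀ v, (l v).Prime) ∧
      ∀ y, c y → ∏ x with ¬ c x ∧ r x y, l x ∣ l y - 1 := by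
  obtain ⟨p, hp, hpp⟩ := exists_injective_mem_of_infinite (fun _ : V => {n | n.Prime})
    fun _ => Nat.infinite_setOfPred_prime
  let D (y : V) : ℕ := ∏ x with ¬ c x ∧ r x y, p x
  have hD (y : V) : D y ≠ 0 := Finset.prod_ne_zero_iff.2 fun x _ => (hpp x).ne_zero
  obtain ⟨q, hq, hqq⟩ := exists_injective_mem_of_infinite
    -- The lower bound keeps the `q y` apart from all the `p x`.
    (fun y : V => {n | n.Prime ∧ ∑ x, p x < n ∧ D y ∣ n - 1}) (by
      intro y
      refine Set.infinite_of_forall_exists_gt fun n => ?_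
      obtain ⟨t, ht, hnt, h1⟩ := Nat.exists_prime_gt_modEq_one (n + ∑ x, p x) (hD y)
      exact ⟨t, ⟨ht, by omega, (Nat.modEq_iff_dvd' ht.one_le).1 h1.symm⟩, by omega⟩)
  have hpq (x y : V) : p x ≠ q y := by
    have h1 := (hqq y).2.1
    have h2 := Finset.single_le_sum (f := p) (fun _ _ => Nat.zero_le _) (Finset.mem_univ x)
    omega
  refine ⟨fun v => if c v then q v else p v, ?_, ?_, ?_⟩
  · intro x y h
    by_cases hx : c x <;> by_cases hy : c y <;> simp only [hx, hy, if_true, if_false] at h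
    · exact hq h
    · exact absurd h.symm (hpq _ _)
    · exact absurd h (hpq _ _)
    · exact hp h
  · intro v
    by_cases hv : c v
    · simpa [hv] using (hqq v).1
    · simpa [hv] using hpp v
  · intro y hy
    simp only [hy, if_true]
    refine (dvd_of_eq (Finset.prod_congr rfl fun x hx => ?_)).trans (hqq y).2.2
    rw [if_neg (Finset.mem_filter.1 hx).2.1]

theorem exists_unit_orderOf_eq {q D : ℕ} (hq : q.Prime) (hD : D ∣ q - 1) :
    ∃ u : (ZMod q)ˣ, orderOf u = D := by
  have := Fact.mk hq
  obtain ⟨g, hg⟩ := IsCyclic.exists_ofOrder_eq_natCard (α := (ZMod q)ˣ)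
  rw [Nat.card_eq_fintype_card, ZMod.card_units] at hg
  refine ⟨g ^ (orderOf g / D), orderOf_pow_orderOf_div (orderOf_pos g).ne' ?_⟩
  rwa [hg]

/-- The Chinese remainder theorem; the first conclusion bounds the order of `u` by those of its
components. -/
theorem exists_unit_prod {ι : Type*} [Fintype ι] (q : ι → ℕ)
    (hq : Pairwise (Function.onFun Nat.Coprime q)) (w : ∀ i, (ZMod (q i))ˣ) :
    ∃ u : (ZMod (∏ i, q i))ˣ, (∀ n, (∀ i, w i ^ n = 1) → u ^ n = 1) ∧
      ∀ i (h : q i ∣ ∏ i, q i), ZMod.castHom h (ZMod (q i)) (u : ZMod (∏ i, q i)) = w i := by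
  let e := ZMod.prodEquivPi q hq
  let W : (∀ i, ZMod (q i))ˣ := MulEquiv.piUnits.symm w
  refine ⟨Units.map (e.symm : _ →* ZMod (∏ i, q i)) W, fun n hn => ?_, fun i h => ?_⟩
  · rw [← map_pow, ← map_pow]
    have : w ^ n = 1 := funext hn
    rw [this, map_one, map_one]
  · have h1 : ZMod.castHom h (ZMod (q i)) =
        (Pi.evalRingHom (fun i => ZMod (q i)) i).comp e.toRingHom :=
      Subsingleton.elim _ _
    rw [h1]
    simp [W]

theorem exists_hom_multiplicative_zmod {H : Type*} [Group H] {M : ℕ} {u : H} (hu : u ^ M = 1) :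
    ∃ θ : Multiplicative (ZMod M) →* H, ∀ j : ℕ, θ (Multiplicative.ofAdd (j : ZMod M)) = u ^ j := by
  let f : ℤ →+ Additive H := zmultiplesHom (Additive H) (Additive.ofMul u)
  have hf : f M = 0 := by
    simp [f, ← ofMul_pow, hu]
  refine ⟨AddMonoidHom.toMultiplicativeLeft (ZMod.lift M ⟨f, hf⟩), fun j => ?_⟩
  have h1 : ZMod.lift M ⟨f, hf⟩ ((j : ℤ) : ZMod M) = f j := ZMod.lift_coe M _ _
  rw [Int.cast_natCast] at h1
  have h2 : f j = Additive.ofMul (u ^ j) := by simp [f]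
  exact congrArg Additive.toMul (h1.trans h2)

end Arithmetic

/-! ### The group realizing a given graph. -/

section Realization

variable {V : Type*} [Finite V]

theorem exists_iso_codegreePrimeGraph (F : SimpleGraph V) (hF : Fᶜ.Colorable 2) :
    ∃ (G : Type) (_ : Group G) (_ : Finite G),
      Squarefree (Nat.card G) ∧ Nonempty (F ≃g codegreePrimeGraph G) := by
  classical
  have := Fintype.ofFinite V
  obtain ⟨C⟩ := hF
  let c : V → Prop := fun v => C v = 0
  have hc {u v : V} (huv : u ≠ v) (h : c u ↔ c v) : F.Adj u v := by
    by_contra hadj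
    refine C.valid ((SimpleGraph.compl_adj F u v).2 ⟨huv, hadj⟩) ?_
    simp only [c] at h
    omega
  obtain ⟨l, hl, hlp, hlD⟩ := exists_prime_labelling c (fun x y => ¬ F.Adj x y)
  have hcop {u v : V} (h : u ≠ v) : Nat.Coprime (l u) (l v) :=
    (Nat.coprime_primes (hlp u) (hlp v)).2 (hl.ne h)
  let N := ∏ y : {v // c v}, l y
  let M := ∏ x : {v // ¬ c v}, l x
  have hNM : N * M = ∏ v, l v := Fintype.prod_subtype_mul_prod_subtype c l
  have hsq : Squarefree (N * M) := by
    rw [hNM]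
    refine Finset.squarefree_prod_of_pairwise_isCoprime ?_ fun v _ => (hlp v).prime.squarefree
    intro u _ v _ huv
    exact Nat.coprime_iff_isRelPrime.1 (hcop huv)
  have hN0 : NeZero N := ⟨left_ne_zero_of_mul hsq.ne_zero⟩
  have hM0 : NeZero M := ⟨right_ne_zero_of_mul hsq.ne_zero⟩
  have hdN {v : V} (hv : c v) : l v ∣ N :=
    Finset.dvd_prod_of_mem (fun y : {v // c v} => l y) (Finset.mem_univ ⟨v, hv⟩)
  have hdM {v : V} (hv : ¬ c v) : l v ∣ M :=
    Finset.dvd_prod_of_mem (fun y : {v // ¬ c v} => l y) (Finset.mem_univ ⟨v, hv⟩)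
  let D (y : V) : ℕ := ∏ x with ¬ c x ∧ ¬ F.Adj x y, l x
  have hDM (y : V) : D y ∣ M := by
    have h1 : M = ∏ x with ¬ c x, l x := (Finset.prod_subtype _ (by simp) l).symm
    rw [h1]
    refine Finset.prod_dvd_prod_of_subset _ _ _ fun x hx => ?_
    simp only [Finset.mem_filter, Finset.mem_univ, true_and] at hx ⊢
    exact hx.1
  have hDl {x : V} (y : V) (hx : ¬ c x) : l x ∣ D y ↔ ¬ F.Adj x y := by
    constructor
    · intro h
      obtain ⟨x', hx', h1⟩ := (hlp x).prime.exists_mem_finset_dvd h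
      rw [Nat.prime_dvd_prime_iff_eq (hlp x) (hlp x')] at h1
      rw [hl h1]
      exact (Finset.mem_filter.1 hx').2.2
    · intro h
      exact Finset.dvd_prod_of_mem l (by simp [hx, h])
  choose w hw using fun y : {v // c v} => exists_unit_orderOf_eq (hlp y) (hlD y y.2)
  obtain ⟨u, huM, hu⟩ := exists_unit_prod (fun y : {v // c v} => l y)
    (fun a b hab => hcop (Subtype.coe_injective.ne hab)) w
  obtain ⟨θ, hθ⟩ := exists_hom_multiplicative_zmod (u := u) (M := M) (huM M fun y =>
    orderOf_dvd_iff_pow_eq_one.1 (hw y ▸ hDM y))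
  -- A generator of the subgroup of order `l x`, when `l x` divides `M`.
  let b (x : V) : Multiplicative (ZMod M) := Multiplicative.ofAdd ((M / l x : ℕ) : ZMod M)
  have hb {x : V} (hx : ¬ c x) : orderOf (b x) = l x := by
    rw [orderOf_ofAdd_eq_addOrderOf, ZMod.addOrderOf_coe _ (NeZero.ne M),
      Nat.gcd_eq_right (Nat.div_dvd_of_dvd (hdM hx)), Nat.div_div_self (hdM hx) (NeZero.ne M)]
  have hbθ {x y : V} (hx : ¬ c x) (hy : c y) :
      ZMod.castHom (hdN hy) (ZMod (l y)) (θ (b x) : ZMod N) = 1 ↔ F.Adj x y := by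
    have h1 := hu ⟨y, hy⟩ (hdN hy)
    rw [hθ, Units.val_pow_eq_pow_val, map_pow, h1, ← Units.val_pow_eq_pow_val, Units.val_eq_one,
      ← orderOf_dvd_iff_pow_eq_one, hw, ← not_iff_not, ← hDl y hx]
    change ¬ D y ∣ _ ↔ _
    -- The component of `θ (b x)` at `y` is `w ^ (M / l x)` with `w` of order `D y`. As `M` is
    -- square-free, `D y` divides `M / l x` exactly when `l x` does not divide `D y`.
    constructor
    · intro h
      by_contra h2
      refine h (((Nat.Prime.coprime_iff_not_dvd (hlp x)).2 h2).symm.dvd_of_dvd_mul_left ?_)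
      rw [Nat.mul_div_cancel' (hdM hx)]
      exact hDM y
    · intro h h2
      have h3 : l x * l x ∣ N * M := by
        refine Dvd.dvd.mul_left ?_ N
        conv_rhs => rw [← Nat.mul_div_cancel' (hdM hx)]
        exact Nat.mul_dvd_mul_left _ (h.trans h2)
      exact (hlp x).one_lt.ne' (Nat.isUnit_iff.1 (hsq _ h3))
  have hcard : Nat.card (AffineGroup θ) = N * M := by
    rw [card_affineGroup, Nat.card_zmod]
    exact congrArg (N * ·) (Nat.card_zmod M)
  obtain ⟨m₁, hm₁, hNm₁, -⟩ := exists_mem_codegrees_of_dvd hsq θ dvd_rfl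
  have hY {v : V} (hv : c v) : l v ∣ m₁ := (hdN hv).trans hNm₁
  -- Over the zero ring `ZMod 1` every `b` acts trivially, so one codegree is divisible by all
  -- primes of `M`.
  obtain ⟨m₂, hm₂, -, hMm₂⟩ := exists_mem_codegrees_of_dvd hsq θ (one_dvd N)
  have hX {v : V} (hv : ¬ c v) : l v ∣ m₂ := hb hv ▸ hMm₂ (b v) (Subsingleton.elim _ _)
  have hmix {x y : V} (hx : ¬ c x) (hy : c y) :
      (∃ m ∈ codegrees (AffineGroup θ), l x * l y ∣ m) ↔ F.Adj x y := by
    constructor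
    · rintro ⟨m, hm, hd⟩
      by_contra h
      have := not_dvd_of_mem_codegrees_affineGroup hsq θ (hlp y) (hdN hy) (b := b x)
        (by rw [hb hx]; exact hlp x) (mt (hbθ hx hy).1 h) hm
      rw [hb hx] at this
      exact this hd
    · intro h
      obtain ⟨m, hm, hd, hbm⟩ := exists_mem_codegrees_of_dvd hsq θ (hdN hy)
      refine ⟨m, hm, (hcop ?_).mul_dvd_of_dvd_of_dvd ?_ hd⟩
      · rintro rfl
        exact hx hy
      · exact hb hx ▸ hbm (b x) ((hbθ hx hy).2 h)
  have hadj {x y : V} (hxy : x ≠ y) :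
      (∃ m ∈ codegrees (AffineGroup θ), l x * l y ∣ m) ↔ F.Adj x y := by
    by_cases hx : c x <;> by_cases hy : c y
    · exact iff_of_true ⟨m₁, hm₁, (hcop hxy).mul_dvd_of_dvd_of_dvd (hY hx) (hY hy)⟩
        (hc hxy (iff_of_true hx hy))
    · rw [mul_comm, F.adj_comm]
      exact hmix hy hx
    · exact hmix hx hy
    · exact iff_of_true ⟨m₂, hm₂, (hcop hxy).mul_dvd_of_dvd_of_dvd (hX hx) (hX hy)⟩
        (hc hxy (iff_of_false hx hy))
  let f (v : V) : Vertex (AffineGroup θ) := ⟨l v, hlp v, by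
    by_cases hv : c v
    · exact ⟨m₁, hm₁, hY hv⟩
    · exact ⟨m₂, hm₂, hX hv⟩⟩
  have hf : Function.Bijective f := by
    refine ⟨fun x y h => hl (congrArg Subtype.val h), fun r => ?_⟩
    obtain ⟨-, m, hm, hr⟩ := r.2
    have h1 := hr.trans (dvd_card_of_mem_codegrees hm)
    rw [hcard, hNM] at h1
    obtain ⟨v, -, h2⟩ := r.2.1.prime.exists_mem_finset_dvd h1
    exact ⟨v, Subtype.ext ((Nat.prime_dvd_prime_iff_eq r.2.1 (hlp v)).1 h2).symm⟩
  refine ⟨AffineGroup θ, inferInstance, inferInstance, by rwa [hcard],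
    ⟨⟨Equiv.ofBijective f hf, ?_⟩⟩⟩
  intro x y
  change (f x ≠ f y ∧ ∃ m ∈ codegrees (AffineGroup θ), l x * l y ∣ m) ↔ F.Adj x y
  rw [hf.1.ne_iff]
  constructor
  · rintro ⟨hxy, h⟩
    exact (hadj hxy).1 h
  · intro h
    exact ⟨h.ne, (hadj h.ne).2 h⟩

end Realization

end CodegreeGraph

theorem corollary3p9 {V : Type*} [Finite V] (F : SimpleGraph V) :
    (∃ (G : Type) (_ : Group G) (_ : Finite G),
      Group.IsSolvable G ∧ Squarefree (Nat.card G) ∧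
        Nonempty (F ≃g CodegreeGraph.codegreePrimeGraph G)) ↔
      Fᶜ.Colorable 2 := by
  constructor
  · rintro ⟨G, _, _, -, hG, ⟨e⟩⟩
    obtain ⟨C⟩ := CodegreeGraph.compl_codegreePrimeGraph_colorable hG
    refine ⟨SimpleGraph.Coloring.mk (fun v => C (e v)) fun {u v} huv => C.valid ?_⟩
    rw [SimpleGraph.compl_adj] at huv ⊢
    exact ⟨e.injective.ne huv.1, fun h => huv.2 (e.map_adj_iff.1 h)⟩
  · intro hF
    obtain ⟨G, _, _, hG, hiso⟩ := CodegreeGraph.exists_iso_codegreePrimeGraph F hF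
    -- Solvability is inferred from the Z-group property.
    have := IsZGroup.of_squarefree hG
    exact ⟨G, _, inferInstance, inferInstance, hG, hiso⟩
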